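/- **Setting.** On a probability space $(\Omega,\mathcal F,\mathbb P)$ let $\{u_k(i)\}_{i\ge1}$, $k=1,2$, and $\{v_j(i)\}_{i\ge 1}$, $j=1,2,3$, be five mutually independent i.i.d. sequences of (almost surely) strictly positive random variables with mean $1$; let $\sigma_k,\varsigma_j$ be the standard deviations of $u_k(1),v_j(1)$. Let $\lambda^n_k,\mu^n_j>0$ $(n\in\mathbb N)$ be rates with $\lambda^n_k\to\lambda_k\in(0,\infty)$ and $\mu^n_j\to\mu_j\in(0,\infty)$. Assume: * (heavy traffic) $\frac{\lambda_1}{\mu_1}+\frac{\lambda_2}{\mu_2}=1$, $\frac{\lambda_2}{\mu_3}=1$, and for some $b_1,b_2,b_3\in\mathbb R$, $\sqrt n\big(\frac{\lambda^n_i}{\mu^n_i}-\frac{\lambda_i}{\mu_i}\big)\to b_i$ $(i=1,2)$ and $\sqrt n\big(\frac{\lambda^n_2}{\mu^n_3}-1\big)\to b_3$; * (exponential moments) $\mathbb E e^{l u_k(1)/\lambda_k}<\infty$ and $\mathbb E e^{l v_j(1)/\mu_j}<\infty$ for all $l$ in some open neighbourhood of $0$, all $k$ and $j$; * (costs) $c_1,c_2,c_3>0$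 are holding costs and $\gamma>0$ a discount factor, with $c_2\mu_2-c_3\mu_2<0\le c_2\mu_2-c_1\mu_1$. **Networks.** In the $n$th crisscross network put $A^n_k(t)=\sup\{l\ge0:\sum_{i\le l}u_k(i)/\lambda^n_k\le t\}$ and $S^n_j(t)=\sup\{l\ge0:\sum_{i\le l}v_j(i)/\mu^n_j\le t\}$. If $T^n_j(t)$ denotes the service time devoted to class $j$ during $[0,t]$, the queue lengths are $Q^n_i(t)=A^n_i(t)-S^n_i(T^n_i(t))$ for $i=1,2$ and $Q^n_3(t)=S^n_2(T^n_2(t))-S^n_3(T^n_3(t))$, and the workloads are $W^n_1=\frac{Q^n_1}{\mu^n_1}+\frac{Q^n_2}{\mu^n_2}$ and $W^n_2=\frac{Q^n_2+Q^n_3}{\mu^n_3}$. Write $\hat Q^n_j(t)=n^{-1/2}Q^n_j(nt)$. **Free boundary.** Let $\hat h(w_1,w_2)=c_1\mu_1w_1+\frac{\mu_3}{\mu_2}(c_2\mu_2-c_1\mu_1)w_2$ if $\mu_3w_2\le\mu_2w_1$, and $\hat h(w_1,w_2)=(c_2\mu_2-c_3\mu_2)w_1+c_3\mu_3w_2$ otherwise.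 For $w\in\mathbb R_+^2$ let $J^*(w)$ be the infimum of $\mathbb E\int_0^\infty e^{-\gamma t}\hat h(W(t))\,dt$, where $W_1=w_1+\frac{X_1}{\mu_1}+\frac{X_2}{\mu_2}+I_1$ and $W_2=w_2+\frac{X_2+X_3}{\mu_3}+I_2$. Here $X$ is, on some filtered probability space, a three-dimensional Brownian motion from $0$ with drift $(\mu_1b_1,\mu_2b_2,\mu_3b_3-\mu_2b_2)$ and covariance matrix $$\begin{pmatrix}\sigma_1^2\lambda_1+\varsigma_1^2\lambda_1&0&0\\0&\sigma_2^2\lambda_2+\varsigma_2^2\lambda_2&-\varsigma_2^2\lambda_2\\0&-\varsigma_2^2\lambda_2&\varsigma_2^2\lambda_2+\varsigma_3^2\mu_3\end{pmatrix},$$ and the infimum is over adapted, right-continuous, componentwise nondecreasing $\mathbb R_+^2$-valued processes $I$ (a jump at time $0$ is allowed) that keep $W_1,W_2\ge0$. Put $\Psi(w_2)=\sup\{w_1\ge0:\partial_{w_1}J^*(w_1,w_2)=0\}$ (one-sided derivative at $w_1=0$). **Policy.** For $l_0>1$, $c>1$, $g_0>0$ put $L^n=\lfloor l_0\log n\rfloor$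 and $C^n=\lfloor c\,l_0\log n\rfloor$. The policy $T^n$ with threshold parameters $l_0,c,g_0$ is the following. Server 2 serves class 3 whenever $Q^n_3>0$. At time $s$, server 1 acts as follows (all quantities at time $s$). * If $Q_3^n-\frac{\mu^n_2}{\mu^n_1}Q_1^n<L^n$: it serves class 1 (if $Q_1^n>0$; otherwise it idles) when $Q_3^n\ge C^n-1$ or $Q_2^n=0$, and serves class 2 when $Q_3^n<C^n-1$ and $Q_2^n>0$. * If $Q_3^n-\frac{\mu^n_2}{\mu^n_1}Q_1^n\ge L^n$: it serves class 1 when $Q_1^n\ge\frac{\mu^n_1}{\mu^n_2}(C^n-L^n+2)$ or ($Q_2^n=0$ and $Q_1^n>0$); when $Q_1^n<\frac{\mu^n_1}{\mu^n_2}(C^n-L^n+2)$ and $Q_2^n>0$, it serves class 2 if $W_1^n-\sqrt n\,\Psi(W_2^n/\sqrt n)\ge g_0$ and idles if $W_1^n-\sqrt n\,\Psi(W_2^n/\sqrt n)<g_0$; it idles if $Q_1^n=Q_2^n=0$. **Event.** Let $\boldsymbol A(n,t)=\{Q^n_3(t)-\frac{\mu^n_2}{\mu^n_1}Q^n_1(t)<L^n\}$,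 let $\kappa(c)=\max\{\frac{4\mu_1}{\mu_2},\frac4{c-1},\frac c{c-1},4\}$, and let $$\mathcal E_\kappa(n,t)=\Big\{\sup_{0\le s\le t}\hat Q^n_3(s)1_{\boldsymbol A(n,ns)}>\tfrac{\kappa(C^n-L^n+1)}{\sqrt n}\Big\}\cup\Big\{\sup_{0\le s\le t}\hat Q^n_1(s)1_{\boldsymbol A(n,ns)^c}>\tfrac{\kappa(C^n-L^n+1)}{\sqrt n}\Big\}.$$ **Theorem.** There exist $\theta_1,\theta_2,\theta_3,\theta_4\in(0,\infty)$ and $n_0\in\mathbb N$ such that for all threshold parameters $l_0>1$, $c>1$, $g_0>0$ and the corresponding sequence of policies $\{T^n\}$, $$\mathbb P(\mathcal E_\kappa(n,t))\le\theta_1(nt+1)^2e^{-\theta_2nt}+\theta_3(nt+1)^3n^{-\theta_4(c-1)l_0}$$ whenever $\kappa\ge\kappa(c)$, $n\ge n_0$ and $nt\ge2$. -/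

import Mathlib

open MeasureTheory ProbabilityTheory Filter Topology Set
open scoped NNReal ENNReal Matrix

noncomputable section

/-- The data of a sequence of crisscross networks on a sample space `Ω`.  Classes `1, 2, 3` of the
network are the indices `0, 1, 2`; the `i`-th customer is the index `i - 1`. -/
structure CrissCross (Ω : Type*) where
  /-- unscaled interarrival variables of the two arrival streams -/
  u : Fin 2 → ℕ → Ω → ℝ
  /-- unscaled service variables of the three classes -/
  v : Fin 3 → ℕ → Ω → ℝ
  /-- arrival rates in the `n`-th network -/
  lamN : ℕ → Fin 2 → ℝ
  /-- service rates in the `n`-th network -/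
  muN : ℕ → Fin 3 → ℝ
  /-- limiting arrival rates -/
  lam : Fin 2 → ℝ
  /-- limiting service rates -/
  mu : Fin 3 → ℝ
  /-- heavy traffic drift parameters -/
  b : Fin 3 → ℝ
  /-- holding costs -/
  cost : Fin 3 → ℝ
  /-- discount factor -/
  disc : ℝ

namespace CrissCross

variable {Ω : Type*} (N : CrissCross Ω)

/-! ### Standing assumptions on the primitives -/

/-- All five sequences of primitive variables as one family. -/
def primitives : (Fin 2 × ℕ) ⊕ (Fin 3 × ℕ) → Ω → ℝ
  | Sum.inl p => N.u p.1 p.2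
  | Sum.inr p => N.v p.1 p.2

/-- The standing assumptions: five mutually independent i.i.d. sequences of positive variables of
mean one, convergence of the rates, heavy traffic, finite moment generating functions near `0`,
and the holding cost regime. -/
structure Assumptions [MeasurableSpace Ω] (P : Measure Ω) : Prop where
  measurable_u : ∀ k i, Measurable (N.u k i)
  measurable_v : ∀ j i, Measurable (N.v j i)
  indep : iIndepFun N.primitives P
  ident_u : ∀ k i, IdentDistrib (N.u k i) (N.u k 0) P P
  ident_v : ∀ j i, IdentDistrib (N.v j i) (N.v j 0) P P
  pos_u : ∀ k i, ∀ᵐ ω ∂P, 0 < N.u k i ω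
  pos_v : ∀ j i, ∀ᵐ ω ∂P, 0 < N.v j i ω
  mean_u : ∀ k, ∫ ω, N.u k 0 ω ∂P = 1
  mean_v : ∀ j, ∫ ω, N.v j 0 ω ∂P = 1
  lamN_pos : ∀ n k, 0 < N.lamN n k
  muN_pos : ∀ n j, 0 < N.muN n j
  lam_pos : ∀ k, 0 < N.lam k
  mu_pos : ∀ j, 0 < N.mu j
  tendsto_lam : ∀ k, Tendsto (fun n => N.lamN n k) atTop (𝓝 (N.lam k))
  tendsto_mu : ∀ j, Tendsto (fun n => N.muN n j) atTop (𝓝 (N.mu j))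
  heavy_one : N.lam 0 / N.mu 0 + N.lam 1 / N.mu 1 = 1
  heavy_two : N.lam 1 / N.mu 2 = 1
  drift_one : Tendsto (fun n : ℕ => √(n : ℝ) * (N.lamN n 0 / N.muN n 0 - N.lam 0 / N.mu 0))
    atTop (𝓝 (N.b 0))
  drift_two : Tendsto (fun n : ℕ => √(n : ℝ) * (N.lamN n 1 / N.muN n 1 - N.lam 1 / N.mu 1))
    atTop (𝓝 (N.b 1))
  drift_three : Tendsto (fun n : ℕ => √(n : ℝ) * (N.lamN n 1 / N.muN n 2 - 1))
    atTop (𝓝 (N.b 2))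
  exp_moments : ∃ O : Set ℝ, IsOpen O ∧ (0 : ℝ) ∈ O ∧ ∀ l ∈ O,
    (∀ k, Integrable (fun ω => Real.exp (l * N.u k 0 ω / N.lam k)) P) ∧
    (∀ j, Integrable (fun ω => Real.exp (l * N.v j 0 ω / N.mu j)) P)
  cost_pos : ∀ j, 0 < N.cost j
  disc_pos : 0 < N.disc
  regime_one : N.cost 1 * N.mu 1 - N.cost 2 * N.mu 1 < 0
  regime_two : 0 ≤ N.cost 1 * N.mu 1 - N.cost 0 * N.mu 0

/-! ### The free boundary of the Brownian workload control problem -/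

/-- Drift of the limiting three-dimensional Brownian motion. -/
def bmDrift : EuclideanSpace ℝ (Fin 3) :=
  !₂[N.mu 0 * N.b 0, N.mu 1 * N.b 1, N.mu 2 * N.b 2 - N.mu 1 * N.b 1]

/-- Covariance matrix of the limiting three-dimensional Brownian motion. -/
def bmCov [MeasurableSpace Ω] (P : Measure Ω) : Matrix (Fin 3) (Fin 3) ℝ :=
  !![Var[N.u 0 0; P] * N.lam 0 + Var[N.v 0 0; P] * N.lam 0, 0, 0;
     0, Var[N.u 1 0; P] * N.lam 1 + Var[N.v 1 0; P] * N.lam 1, -(Var[N.v 1 0; P] * N.lam 1);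
     0, -(Var[N.v 1 0; P] * N.lam 1), Var[N.v 1 0; P] * N.lam 1 + Var[N.v 2 0; P] * N.mu 2]

/-- `X` is a three-dimensional Brownian motion with drift `b` and covariance matrix `S`, started
at the origin, relative to the filtration `𝓕`. -/
structure IsBM {Ω' : Type} [mΩ : MeasurableSpace Ω'] (P' : Measure Ω') (𝓕 : Filtration ℝ≥0 mΩ)
    (X : ℝ≥0 → Ω' → EuclideanSpace ℝ (Fin 3)) (b : EuclideanSpace ℝ (Fin 3))
    (S : Matrix (Fin 3) (Fin 3) ℝ) : Prop where
  adapted : Adapted 𝓕 X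
  zero : ∀ ω, X 0 ω = 0
  continuous : ∀ ω, Continuous fun t => X t ω
  indep : ∀ s t, s ≤ t → Indep (MeasurableSpace.comap (X t - X s) inferInstance) (𝓕 s) P'
  law : ∀ s t : ℝ≥0, s ≤ t → P'.map (X t - X s) =
    multivariateGaussian (((t : ℝ) - s) • b) (((t : ℝ) - s) • S)

/-- The effective cost: the value of the linear program of minimizing the holding cost rate given
the workloads `w₁, w₂` at the two servers. -/
def hHat (w₁ w₂ : ℝ) : ℝ :=
  if N.mu 2 * w₂ ≤ N.mu 1 * w₁ then
    N.cost 0 * N.mu 0 * w₁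
      + N.mu 2 / N.mu 1 * (N.cost 1 * N.mu 1 - N.cost 0 * N.mu 0) * w₂
  else
    (N.cost 1 * N.mu 1 - N.cost 2 * N.mu 1) * w₁ + N.cost 2 * N.mu 2 * w₂

/-- Workload at server 1 in the limit problem, with initial condition `w₁`. -/
def limW₁ {Ω' : Type} (w₁ : ℝ) (X : ℝ≥0 → Ω' → EuclideanSpace ℝ (Fin 3))
    (I : ℝ≥0 → Ω' → Fin 2 → ℝ) (t : ℝ≥0) (ω : Ω') : ℝ :=
  w₁ + (X t ω 0 / N.mu 0 + X t ω 1 / N.mu 1) + I t ω 0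

/-- Workload at server 2 in the limit problem, with initial condition `w₂`. -/
def limW₂ {Ω' : Type} (w₂ : ℝ) (X : ℝ≥0 → Ω' → EuclideanSpace ℝ (Fin 3))
    (I : ℝ≥0 → Ω' → Fin 2 → ℝ) (t : ℝ≥0) (ω : Ω') : ℝ :=
  w₂ + (X t ω 1 / N.mu 2 + X t ω 2 / N.mu 2) + I t ω 1

/-- `I` is an admissible control of the workload problem for the initial condition `(w₁, w₂)`:
adapted, nonnegative, nondecreasing, right continuous (with left limits, by monotonicity), and
keeping both workloads nonnegative.  A jump at time `0` is allowed. -/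
structure IsEWFControl {Ω' : Type} [mΩ : MeasurableSpace Ω'] (𝓕 : Filtration ℝ≥0 mΩ)
    (X : ℝ≥0 → Ω' → EuclideanSpace ℝ (Fin 3)) (w₁ w₂ : ℝ) (I : ℝ≥0 → Ω' → Fin 2 → ℝ) :
    Prop where
  adapted : Adapted 𝓕 I
  nonneg : ∀ t ω j, 0 ≤ I t ω j
  mono : ∀ ω j, Monotone fun t => I t ω j
  right_cont : ∀ ω t, ContinuousWithinAt (fun s => I s ω) (Ici t) t
  workload₁ : ∀ t ω, 0 ≤ N.limW₁ w₁ X I t ω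
  workload₂ : ∀ t ω, 0 ≤ N.limW₂ w₂ X I t ω

/-- The expected discounted cost of a control (the integrand is nonnegative). -/
def ewfCost {Ω' : Type} [MeasurableSpace Ω'] (P' : Measure Ω')
    (X : ℝ≥0 → Ω' → EuclideanSpace ℝ (Fin 3)) (w₁ w₂ : ℝ) (I : ℝ≥0 → Ω' → Fin 2 → ℝ) : ℝ≥0∞ :=
  ∫⁻ ω, (∫⁻ t in Ioi (0 : ℝ), ENNReal.ofReal (Real.exp (-N.disc * t) *
    N.hHat (N.limW₁ w₁ X I t.toNNReal ω) (N.limW₂ w₂ X I t.toNNReal ω))) ∂P'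

/-- The value function `J*` of the workload control problem: the infimum of the cost over all
filtered probability spaces, Brownian motions on them and admissible controls. -/
def valueJ [MeasurableSpace Ω] (P : Measure Ω) (w₁ w₂ : ℝ) : ℝ :=
  (sInf {J : ℝ≥0∞ | ∃ (Ω' : Type) (mΩ : MeasurableSpace Ω') (P' : Measure Ω')
      (𝓕 : Filtration ℝ≥0 mΩ) (X : ℝ≥0 → Ω' → EuclideanSpace ℝ (Fin 3))
      (I : ℝ≥0 → Ω' → Fin 2 → ℝ), IsProbabilityMeasure P' ∧
      IsBM P' 𝓕 X N.bmDrift (N.bmCov P) ∧ N.IsEWFControl 𝓕 X w₁ w₂ I ∧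
      J = N.ewfCost P' X w₁ w₂ I}).toReal

/-- The free boundary `Ψ(w₂) = sup {w₁ ≥ 0 : ∂J*/∂w₁ (w₁, w₂) = 0}`; the derivative is taken
within `[0, ∞)`, hence one-sided at `w₁ = 0`. -/
def freeBoundary [MeasurableSpace Ω] (P : Measure Ω) (w₂ : ℝ) : ℝ :=
  sSup {w₁ : ℝ | 0 ≤ w₁ ∧ HasDerivWithinAt (fun x => N.valueJ P x w₂) 0 (Ici 0) w₁}

/-! ### The networks -/

/-- Time of the `l`-th class-`k` arrival in the `n`-th network. -/
def arrivalTime (n : ℕ) (k : Fin 2) (l : ℕ) (ω : Ω) : ℝ :=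
  ∑ i ∈ Finset.range l, N.u k i ω / N.lamN n k

/-- Total service requirement of the first `l` class-`j` customers in the `n`-th network. -/
def serviceTime (n : ℕ) (j : Fin 3) (l : ℕ) (ω : Ω) : ℝ :=
  ∑ i ∈ Finset.range l, N.v j i ω / N.muN n j

/-- The arrival process `A^n_k`. -/
def arrivals (n : ℕ) (k : Fin 2) (t : ℝ) (ω : Ω) : ℕ :=
  sSup {l : ℕ | N.arrivalTime n k l ω ≤ t}

/-- The service process `S^n_j`. -/
def services (n : ℕ) (j : Fin 3) (t : ℝ) (ω : Ω) : ℕ :=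
  sSup {l : ℕ | N.serviceTime n j l ω ≤ t}

/-- The queue lengths at time `t` under the allocation process `T`, where `T j t ω` is the time
devoted to class `j` during `[0, t]`. -/
def queue (n : ℕ) (T : Fin 3 → ℝ → Ω → ℝ) (t : ℝ) (ω : Ω) : Fin 3 → ℝ :=
  ![(N.arrivals n 0 t ω : ℝ) - N.services n 0 (T 0 t ω) ω,
    (N.arrivals n 1 t ω : ℝ) - N.services n 1 (T 1 t ω) ω,
    (N.services n 1 (T 1 t ω) ω : ℝ) - N.services n 2 (T 2 t ω) ω]

/-- The workload at server 1 when the queue lengths are `q`. -/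
def workload₁ (n : ℕ) (q : Fin 3 → ℝ) : ℝ := q 0 / N.muN n 0 + q 1 / N.muN n 1

/-- The workload at server 2 when the queue lengths are `q`. -/
def workload₂ (n : ℕ) (q : Fin 3 → ℝ) : ℝ := q 1 / N.muN n 2 + q 2 / N.muN n 2

/-! ### The threshold policy -/

/-- The threshold `L^n = ⌊l₀ log n⌋`. -/
def threshL (l₀ : ℝ) (n : ℕ) : ℝ := (⌊l₀ * Real.log n⌋ : ℤ)

/-- The threshold `C^n = ⌊c l₀ log n⌋`. -/
def threshC (c l₀ : ℝ) (n : ℕ) : ℝ := (⌊c * l₀ * Real.log n⌋ : ℤ)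

/-- The region `Q₃ - (μ₂ⁿ/μ₁ⁿ) Q₁ < L^n`. -/
def InA (l₀ : ℝ) (n : ℕ) (q : Fin 3 → ℝ) : Prop :=
  q 2 - N.muN n 1 / N.muN n 0 * q 0 < threshL l₀ n

/-- `Q₁` has reached the level `(μ₁ⁿ/μ₂ⁿ)(C^n - L^n + 2)`. -/
def InH (c l₀ : ℝ) (n : ℕ) (q : Fin 3 → ℝ) : Prop :=
  N.muN n 0 / N.muN n 1 * (threshC c l₀ n - threshL l₀ n + 2) ≤ q 0

/-- Queue length states in which the policy has the server of class `j` work on class `j`.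
In all states in which neither class 1 nor class 2 is served, server 1 idles. -/
def Serve [MeasurableSpace Ω] (P : Measure Ω) (c l₀ g₀ : ℝ) (n : ℕ) (q : Fin 3 → ℝ) :
    Fin 3 → Prop :=
  ![(N.InA l₀ n q ∧ 0 < q 0 ∧ (threshC c l₀ n - 1 ≤ q 2 ∨ q 1 = 0)) ∨
      (¬ N.InA l₀ n q ∧ (N.InH c l₀ n q ∨ (q 1 = 0 ∧ 0 < q 0))),
    (N.InA l₀ n q ∧ q 2 < threshC c l₀ n - 1 ∧ 0 < q 1) ∨
      (¬ N.InA l₀ n q ∧ ¬ N.InH c l₀ n q ∧ 0 < q 1 ∧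
        g₀ ≤ N.workload₁ n q
          - √(n : ℝ) * N.freeBoundary P (N.workload₂ n q / √(n : ℝ))),
    0 < q 2]

/-- `T` is the allocation process of the threshold policy in the `n`-th network: almost surely, for
every `t ≥ 0` and every class `j`, `T j t` is the length of the set of times in `(0, t]` at which
the policy has class `j` served. -/
def IsPolicy [MeasurableSpace Ω] (P : Measure Ω) (c l₀ g₀ : ℝ) (n : ℕ)
    (T : Fin 3 → ℝ → Ω → ℝ) : Prop :=
  ∀ᵐ ω ∂P, ∀ t : ℝ, 0 ≤ t → ∀ j,
    T j t ω = volume.real {s : ℝ | s ∈ Ioc 0 t ∧ N.Serve P c l₀ g₀ n (N.queue n T s ω) j}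

/-! ### The event -/

/-- The diffusion-scaled queue length `n^{-1/2} Q^n_j(n t)`. -/
def queueHat (n : ℕ) (T : Fin 3 → ℝ → Ω → ℝ) (j : Fin 3) (t : ℝ) (ω : Ω) : ℝ :=
  N.queue n T (n * t) ω j / √(n : ℝ)

/-- The event `A(n, t)`. -/
def eventA (l₀ : ℝ) (n : ℕ) (T : Fin 3 → ℝ → Ω → ℝ) (t : ℝ) : Set Ω :=
  {ω | N.InA l₀ n (N.queue n T t ω)}

/-- The lower bound `κ(c)`. -/
def kappaMin (c : ℝ) : ℝ :=
  max (max (4 * N.mu 0 / N.mu 1) (4 / (c - 1))) (max (c / (c - 1)) 4)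

/-- The event `E_κ(n, t)`; the suprema are taken in the extended reals. -/
def eventE (c l₀ κ : ℝ) (n : ℕ) (T : Fin 3 → ℝ → Ω → ℝ) (t : ℝ) : Set Ω :=
  {ω | ((κ * (threshC c l₀ n - threshL l₀ n + 1) / √(n : ℝ) : ℝ) : EReal) <
      ⨆ s ∈ Icc 0 t,
        (((N.eventA l₀ n T (n * s)).indicator (N.queueHat n T 2 s) ω : ℝ) : EReal)} ∪
  {ω | ((κ * (threshC c l₀ n - threshL l₀ n + 1) / √(n : ℝ) : ℝ) : EReal) <
      ⨆ s ∈ Icc 0 t,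
        (((N.eventA l₀ n T (n * s))ᶜ.indicator (N.queueHat n T 0 s) ω : ℝ) : EReal)}

end CrissCross

end

/-! Class 1 alone is stable when server 1 works on it full time, since heavy traffic forces `lam 0 <
mu 0`. Write `D = C - L + 1` and `a = muN 0 / muN 1`. On the event, one queue is long and the
defining inequality of the region makes the other long too: at some time `τ`, class 1 holds at least
`3aD` customers and class 3 at least `L + 3D` (`exists_of_mem_eventE`).

Trace back from `τ` through the period in which class 1 is at or above `a(D + 1)` and class 3 at or
above `C - 1`. In both regions of the policy, server 1 then works on class 1 only. Class 2 sends
nothing to class 3 meanwhile, so class 3 was already long when the period began. Hence the period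
began with class 1 below `a(D + 1)` (`exists_not_inH`). Class 1 has thus grown by more than `a(2D -
1)` under uninterrupted service, so a block of `m + q` interarrival times exceeds a block of `m`
service times by at most one, with `q` of order `D` (`exists_blocks`).

For fixed blocks this has probability at most `exp (s - s * ρ * q)`, where `ρ` lies between the mean
service and interarrival times: in the Chernoff bound `measureReal_sum_sub_sum_le` the `m` service
factors cancel against `m` interarrival factors. A union bound over the two starting points and the
length gives the cubic factor, and the number of arrivals is of order `nt` outside an event of
exponentially small probability (`measureReal_eventE_le`). As `D ≥ (c - 1) * l₀ * log n`,
exponential decay in `q` is a negative power of `n`. -/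

/-! ### Exponential tilting -/

section Tilting

variable {Ω : Type*} [MeasurableSpace Ω] {P : Measure Ω}

/-- For small positive parameters the moment generating function lies below an exponential whose
rate exceeds the mean. -/
theorem eventually_mgf_const_mul_le [IsProbabilityMeasure P] {X : Ω → ℝ}
    (h0 : (0 : ℝ) ∈ interior (integrableExpSet X P)) {a ρ : ℝ} (h : a * ∫ ω, X ω ∂P < ρ) :
    ∀ᶠ s in 𝓝[>] (0 : ℝ), Integrable (fun ω => Real.exp (s * (a * X ω))) P ∧
      mgf (fun ω => a * X ω) P s ≤ Real.exp (s * ρ) := by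
  have hcont : Tendsto (fun s : ℝ => a * s) (𝓝 0) (𝓝 0) := by
    have : Continuous fun s : ℝ => a * s := by fun_prop
    simpa using this.tendsto 0
  have h1 : ∀ᶠ s in 𝓝[>] (0 : ℝ), a * s ∈ integrableExpSet X P :=
    (hcont.eventually (mem_interior_iff_mem_nhds.mp h0)).filter_mono nhdsWithin_le_nhds
  -- The difference vanishes at `0` with negative derivative, so it is negative just to the right of
  -- `0`.
  have hd : HasDerivAt (fun s => mgf X P (a * s) - Real.exp (s * ρ)) (a * ∫ ω, X ω ∂P - ρ) 0 := by
    have hm : HasDerivAt (mgf X P) (∫ ω, X ω ∂P) (a * 0) := by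
      have := hasDerivAt_mgf h0
      simpa using this
    have h2 := hm.comp (0 : ℝ) ((hasDerivAt_id (0 : ℝ)).const_mul a)
    have h3 : HasDerivAt (fun s : ℝ => Real.exp (s * ρ)) ρ 0 := by
      have := ((hasDerivAt_id (0 : ℝ)).mul_const ρ).exp
      simpa using this
    have h4 := h2.sub h3
    refine (h4.congr_deriv ?_)
    ring
  have h5 : ∀ᶠ s in 𝓝[>] (0 : ℝ), mgf X P (a * s) - Real.exp (s * ρ) < 0 := by
    have hs := (hasDerivAt_iff_tendsto_slope.mp hd).mono_left
      (nhdsWithin_mono 0 (fun x (hx : (0 : ℝ) < x) => ne_of_gt hx : Ioi (0 : ℝ) ⊆ {0}ᶜ))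
    filter_upwards [hs.eventually (gt_mem_nhds (sub_neg.mpr h)), self_mem_nhdsWithin] with s hs hpos
    have hpos : (0 : ℝ) < s := hpos
    rw [slope_def_field] at hs
    simp only [mul_zero, mgf_zero, zero_mul, Real.exp_zero, sub_self, sub_zero] at hs
    by_contra hcon
    exact absurd hs (not_lt.mpr (div_nonneg (not_lt.mp hcon) hpos.le))
  filter_upwards [h1, h5] with s hs1 hs2
  refine ⟨?_, ?_⟩
  · have : Integrable (fun ω => Real.exp (a * s * X ω)) P := hs1
    refine this.congr (Eventually.of_forall fun ω => ?_)
    ring_nf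
  · rw [mgf_const_mul]
    linarith

/-- Chernoff bound for the difference of two independent partial sums. -/
theorem measureReal_sum_sub_sum_le [IsProbabilityMeasure P] {U V : ℕ → Ω → ℝ}
    (hmU : ∀ i, Measurable (U i)) (hmV : ∀ i, Measurable (V i))
    (hind : iIndepFun (Sum.elim U V) P) {s ρ r₁ r₂ : ℝ} (hs : 0 ≤ s)
    (hU : ∀ i, Integrable (fun ω => Real.exp (s * (-r₂ * U i ω))) P ∧
      mgf (fun ω => -r₂ * U i ω) P s ≤ Real.exp (s * -ρ))
    (hV : ∀ i, Integrable (fun ω => Real.exp (s * (r₁ * V i ω))) P ∧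
      mgf (fun ω => r₁ * V i ω) P s ≤ Real.exp (s * ρ)) (I J : Finset ℕ) (x : ℝ) :
    P.real {ω | r₂ * ∑ i ∈ I, U i ω - r₁ * ∑ i ∈ J, V i ω ≤ x} ≤
      Real.exp (s * x - s * ρ * (I.card - J.card)) := by
  set X : ℕ ⊕ ℕ → Ω → ℝ :=
    Sum.elim (fun i ω => -r₂ * U i ω) (fun i ω => r₁ * V i ω) with hX
  have hXind : iIndepFun X P := by
    have := hind.comp (fun i => Sum.elim (fun _ x => -r₂ * x) (fun _ x => r₁ * x) i) (by
      rintro (i | i)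
      · exact measurable_const_mul (-r₂)
      · exact measurable_const_mul r₁)
    convert this using 1
    ext i
    rcases i with i | i <;> rfl
  have hXm : ∀ i, Measurable (X i) := by
    rintro (i | i)
    · exact (hmU i).const_mul (-r₂)
    · exact (hmV i).const_mul r₁
  have hint := hXind.integrable_exp_mul_sum (t := s) hXm (s := I.disjSum J) (by
    rintro (i | i) -
    · exact (hU i).1
    · exact (hV i).1)
  have h1 := measure_ge_le_exp_mul_mgf (-x) hs hint
  rw [hXind.mgf_sum hXm, Finset.prod_disjSum] at h1
  have hsub : {ω | r₂ * ∑ i ∈ I, U i ω - r₁ * ∑ i ∈ J, V i ω ≤ x} =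
      {ω | -x ≤ (∑ i ∈ I.disjSum J, X i) ω} := by
    ext ω
    simp only [mem_ofPred_eq, Finset.sum_apply, Finset.sum_disjSum, hX, Sum.elim_inl, Sum.elim_inr,
      ← Finset.mul_sum]
    constructor <;> intro h <;> linarith
  rw [hsub]
  refine h1.trans ?_
  have hpI : ∏ i ∈ I, mgf (X (Sum.inl i)) P s ≤ Real.exp (s * -ρ) ^ I.card :=
    (Finset.prod_le_prod (fun _ _ => mgf_nonneg) fun i _ => (hU i).2).trans_eq (Finset.prod_const _)
  have hpJ : ∏ i ∈ J, mgf (X (Sum.inr i)) P s ≤ Real.exp (s * ρ) ^ J.card :=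
    (Finset.prod_le_prod (fun _ _ => mgf_nonneg) fun i _ => (hV i).2).trans_eq (Finset.prod_const _)
  calc _ ≤ Real.exp (-s * -x) * (Real.exp (s * -ρ) ^ I.card * Real.exp (s * ρ) ^ J.card) := by
        refine mul_le_mul_of_nonneg_left (mul_le_mul hpI hpJ ?_ (by positivity)) (by positivity)
        exact Finset.prod_nonneg fun i _ => mgf_nonneg
    _ = _ := by
        rw [← Real.exp_nat_mul, ← Real.exp_nat_mul, ← Real.exp_add, ← Real.exp_add]
        congr 1
        ring

/-- Partial sums of an i.i.d. sequence with positive mean diverge almost surely. -/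
theorem ae_tendsto_sum_atTop {X : ℕ → Ω → ℝ} (hint : Integrable (X 0) P)
    (hind : iIndepFun X P) (hid : ∀ i, IdentDistrib (X i) (X 0) P P)
    (hmean : 0 < ∫ ω, X 0 ω ∂P) :
    ∀ᵐ ω ∂P, Tendsto (fun l => ∑ i ∈ Finset.range l, X i ω) atTop atTop := by
  filter_upwards [strong_law_ae_real X hint (fun i j hij => hind.indepFun hij) hid] with ω hω
  have := hω.pos_mul_atTop hmean (tendsto_natCast_atTop_atTop (R := ℝ))
  refine this.congr' ?_
  filter_upwards [eventually_gt_atTop 0] with l hl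
  have : (l : ℝ) ≠ 0 := by positivity
  field_simp

end Tilting

/-! ### Counting processes of positive sequences -/

section Counting

variable {f : ℕ → ℝ}

/-- The number of terms of `f` that are completed by time `t`. -/
noncomputable def renewalCount (f : ℕ → ℝ) (t : ℝ) : ℕ := sSup {l : ℕ | ∑ i ∈ Finset.range l, f i ≤ t}

/-- An unbounded set of naturals has `sSup` equal to `0`, so divergence of the partial sums is what
makes `renewalCount` a true count. -/
theorem bddAbove_setOf_sum_range_le
    (htop : Tendsto (fun l => ∑ i ∈ Finset.range l, f i) atTop atTop) (t : ℝ) :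
    BddAbove {l : ℕ | ∑ i ∈ Finset.range l, f i ≤ t} := by
  obtain ⟨m, hm⟩ := eventually_atTop.mp (htop.eventually_gt_atTop t)
  exact ⟨m, fun l hl => not_lt.mp fun h => absurd (hm l h.le) (not_lt.mpr hl)⟩

theorem sum_range_renewalCount_le
    (htop : Tendsto (fun l => ∑ i ∈ Finset.range l, f i) atTop atTop) {t : ℝ} (ht : 0 ≤ t) :
    ∑ i ∈ Finset.range (renewalCount f t), f i ≤ t :=
  Nat.sSup_mem ⟨0, by simpa using ht⟩ (bddAbove_setOf_sum_range_le htop t)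

theorem lt_sum_range_renewalCount_add_one
    (htop : Tendsto (fun l => ∑ i ∈ Finset.range l, f i) atTop atTop) (t : ℝ) :
    t < ∑ i ∈ Finset.range (renewalCount f t + 1), f i := by
  by_contra! h
  exact absurd (le_csSup (bddAbove_setOf_sum_range_le htop t) h) (Nat.not_succ_le_self _)

theorem renewalCount_mono
    (htop : Tendsto (fun l => ∑ i ∈ Finset.range l, f i) atTop atTop) {s t : ℝ} (hs : 0 ≤ s)
    (hst : s ≤ t) : renewalCount f s ≤ renewalCount f t :=
  csSup_le_csSup (bddAbove_setOf_sum_range_le htop t) ⟨0, by simpa using hs⟩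
    fun _ hl => le_trans hl hst

theorem renewalCount_zero (hpos : ∀ i, 0 < f i) : renewalCount f 0 = 0 := by
  have : {l : ℕ | ∑ i ∈ Finset.range l, f i ≤ 0} = {0} := by
    ext l
    simp only [mem_ofPred_eq, mem_singleton_iff]
    constructor
    · intro h
      by_contra hl
      exact absurd h (not_le.mpr (Finset.sum_pos (fun i _ => hpos i) (by simpa using hl)))
    · rintro rfl
      simp
  rw [renewalCount, this, csSup_singleton]

theorem sum_range_le_sum_range (hpos : ∀ i, 0 < f i) {a b : ℕ} (hab : a ≤ b) :
    ∑ i ∈ Finset.range a, f i ≤ ∑ i ∈ Finset.range b, f i :=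
  Finset.sum_le_sum_of_subset_of_nonneg (Finset.range_mono hab) fun i _ _ => (hpos i).le

/-- On short time intervals the counting process increases by at most one. -/
theorem exists_renewalCount_le_add_one (hpos : ∀ i, 0 < f i)
    (htop : Tendsto (fun l => ∑ i ∈ Finset.range l, f i) atTop atTop) {t : ℝ} (ht : 0 ≤ t) :
    ∃ ε > 0, ∀ s, 0 ≤ s → s ≤ t → t ≤ s + ε → renewalCount f t ≤ renewalCount f s + 1 := by
  set m := renewalCount f t
  -- The length of the last completed term: two more completions after `s` would place this whole
  -- term strictly inside the interval from `s` to `t`.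
  refine ⟨f (m - 1), hpos _, fun s hs hst hε => ?_⟩
  by_contra! h
  have h1 := sum_range_renewalCount_le htop ht
  have h2 := lt_sum_range_renewalCount_add_one htop s
  have h3 : ∑ i ∈ Finset.range (m - 1), f i + f (m - 1) = ∑ i ∈ Finset.range m, f i := by
    rw [← Finset.sum_range_succ, Nat.sub_add_cancel (by omega)]
  have h4 := sum_range_le_sum_range hpos (show renewalCount f s + 1 ≤ m - 1 by omega)
  linarith

end Counting

namespace CrissCross

variable {Ω : Type*}

/-! ### Sample paths -/

/-- The properties of a sample point, valid almost surely, that the path arguments use. -/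
structure IsRegularPath [MeasurableSpace Ω] (N : CrissCross Ω) (P : Measure Ω) (c l₀ g₀ : ℝ)
    (n : ℕ) (T : Fin 3 → ℝ → Ω → ℝ) (ω : Ω) : Prop where
  pos_u : ∀ k i, 0 < N.u k i ω
  pos_v : ∀ j i, 0 < N.v j i ω
  pos_arr : ∀ k i, 0 < N.u k i ω / N.lamN n k
  pos_srv : ∀ j i, 0 < N.v j i ω / N.muN n j
  tendsto_arr : ∀ k, Tendsto (fun l => ∑ i ∈ Finset.range l, N.u k i ω / N.lamN n k) atTop atTop
  tendsto_srv : ∀ j, Tendsto (fun l => ∑ i ∈ Finset.range l, N.v j i ω / N.muN n j) atTop atTop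
  alloc : ∀ t : ℝ, 0 ≤ t → ∀ j,
    T j t ω = volume.real {s : ℝ | s ∈ Ioc 0 t ∧ N.Serve P c l₀ g₀ n (N.queue n T s ω) j}

namespace IsRegularPath

variable [MeasurableSpace Ω] {N : CrissCross Ω} {P : Measure Ω} {c l₀ g₀ : ℝ} {n : ℕ}
  {T : Fin 3 → ℝ → Ω → ℝ} {ω : Ω}

theorem alloc_sub (h : N.IsRegularPath P c l₀ g₀ n T ω) (j : Fin 3) {s t : ℝ} (hs : 0 ≤ s)
    (hst : s ≤ t) :
    T j t ω - T j s ω =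
      volume.real {r : ℝ | r ∈ Ioc s t ∧ N.Serve P c l₀ g₀ n (N.queue n T r ω) j} := by
  rw [h.alloc t (hs.trans hst), h.alloc s hs]
  set A := {r : ℝ | r ∈ Ioc 0 t ∧ N.Serve P c l₀ g₀ n (N.queue n T r ω) j}
  have hfin : volume A ≠ ⊤ :=
    ((measure_mono fun r hr => hr.1 : volume A ≤ volume (Ioc 0 t)).trans_lt
      measure_Ioc_lt_top).ne
  -- Only the cutting interval has to be measurable, so no measurability of the set of service times
  -- is required.
  have h1 := measureReal_inter_add_sdiff (μ := volume) (s := A) (measurableSet_Ioc (a := 0) (b := s))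
    hfin
  have h2 : A ∩ Ioc 0 s =
      {r : ℝ | r ∈ Ioc 0 s ∧ N.Serve P c l₀ g₀ n (N.queue n T r ω) j} := by
    ext r
    simp only [A, mem_inter_iff, mem_ofPred_eq, mem_Ioc]
    constructor
    · rintro ⟨⟨-, a⟩, b⟩
      exact ⟨b, a⟩
    · rintro ⟨⟨a, b⟩, d⟩
      exact ⟨⟨⟨a, b.trans hst⟩, d⟩, a, b⟩
  have h3 : A \ Ioc 0 s =
      {r : ℝ | r ∈ Ioc s t ∧ N.Serve P c l₀ g₀ n (N.queue n T r ω) j} := by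
    ext r
    simp only [A, Set.mem_sdiff, mem_ofPred_eq, mem_Ioc, not_and, not_le]
    constructor
    · rintro ⟨⟨⟨a, b⟩, d⟩, e⟩
      exact ⟨⟨e a, b⟩, d⟩
    · rintro ⟨⟨a, b⟩, d⟩
      exact ⟨⟨⟨hs.trans_lt a, b⟩, d⟩, fun _ => a⟩
  rw [h2, h3] at h1
  linarith

theorem alloc_zero (h : N.IsRegularPath P c l₀ g₀ n T ω) (j : Fin 3) : T j 0 ω = 0 := by
  simp [h.alloc 0 le_rfl j]

theorem alloc_mono (h : N.IsRegularPath P c l₀ g₀ n T ω) (j : Fin 3) {s t : ℝ} (hs : 0 ≤ s)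
    (hst : s ≤ t) : T j s ω ≤ T j t ω := by
  have := h.alloc_sub j hs hst
  have h0 := measureReal_nonneg (μ := (volume : Measure ℝ))
    (s := {r : ℝ | r ∈ Ioc s t ∧ N.Serve P c l₀ g₀ n (N.queue n T r ω) j})
  linarith

theorem alloc_nonneg (h : N.IsRegularPath P c l₀ g₀ n T ω) (j : Fin 3) {t : ℝ} (ht : 0 ≤ t) :
    0 ≤ T j t ω := by
  have := h.alloc_mono j le_rfl ht
  rwa [h.alloc_zero] at this

theorem alloc_sub_of_serve (h : N.IsRegularPath P c l₀ g₀ n T ω) {j : Fin 3} {s t : ℝ}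
    (hs : 0 ≤ s) (hst : s ≤ t)
    (hserve : ∀ r ∈ Ioc s t, N.Serve P c l₀ g₀ n (N.queue n T r ω) j) :
    T j t ω - T j s ω = t - s := by
  rw [h.alloc_sub j hs hst]
  have : {r : ℝ | r ∈ Ioc s t ∧ N.Serve P c l₀ g₀ n (N.queue n T r ω) j} = Ioc s t := by
    ext r
    exact ⟨fun hr => hr.1, fun hr => ⟨hr, hserve r hr⟩⟩
  rw [this, Real.volume_real_Ioc_of_le hst]

theorem alloc_eq_of_not_serve (h : N.IsRegularPath P c l₀ g₀ n T ω) {j : Fin 3} {s t : ℝ}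
    (hs : 0 ≤ s) (hst : s ≤ t)
    (hserve : ∀ r ∈ Ioc s t, ¬ N.Serve P c l₀ g₀ n (N.queue n T r ω) j) :
    T j t ω = T j s ω := by
  have h1 := h.alloc_sub j hs hst
  have : {r : ℝ | r ∈ Ioc s t ∧ N.Serve P c l₀ g₀ n (N.queue n T r ω) j} = ∅ := by
    ext r
    simp only [mem_ofPred_eq, mem_empty_iff_false, iff_false, not_and]
    exact hserve r
  rw [this, measureReal_empty] at h1
  linarith

theorem alloc_sub_le (h : N.IsRegularPath P c l₀ g₀ n T ω) (j : Fin 3) {s t : ℝ} (hs : 0 ≤ s)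
    (hst : s ≤ t) : T j t ω - T j s ω ≤ t - s := by
  rw [h.alloc_sub j hs hst, ← Real.volume_real_Ioc_of_le hst]
  exact measureReal_mono (fun r hr => hr.1) measure_Ioc_lt_top.ne

theorem services_mono (h : N.IsRegularPath P c l₀ g₀ n T ω) (j : Fin 3) {s t : ℝ} (hs : 0 ≤ s)
    (hst : s ≤ t) : N.services n j (T j s ω) ω ≤ N.services n j (T j t ω) ω :=
  renewalCount_mono (h.tendsto_srv j) (h.alloc_nonneg j hs) (h.alloc_mono j hs hst)

theorem queue_zero (h : N.IsRegularPath P c l₀ g₀ n T ω) : N.queue n T 0 ω 0 = 0 := by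
  have h1 : N.arrivals n 0 0 ω = 0 := renewalCount_zero (h.pos_arr 0)
  have h2 : N.services n 0 0 ω = 0 := renewalCount_zero (h.pos_srv 0)
  simp [queue, h.alloc_zero, h1, h2]

/-- If class `1` and class `3` are both far above their thresholds at time `τ`, then server `1` has
worked on class `1` since shortly after a time at which class `1` was below its threshold. -/
theorem exists_not_inH (h : N.IsRegularPath P c l₀ g₀ n T ω)
    (hmu : ∀ j, 0 < N.muN n j) (hD : 1 ≤ threshC c l₀ n - threshL l₀ n + 1) {τ : ℝ} (hτ : 0 ≤ τ)
    (h3 : threshL l₀ n + 3 * (threshC c l₀ n - threshL l₀ n + 1) ≤ N.queue n T τ ω 2) :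
    ∃ s, 0 ≤ s ∧ s ≤ τ ∧ ¬ N.InH c l₀ n (N.queue n T s ω) ∧
      τ - s - 1 ≤ T 0 τ ω - T 0 s ω := by
  have ha : 0 < N.muN n 0 / N.muN n 1 := div_pos (hmu 0) (hmu 1)
  -- The times at which the policy need not favour class 1. Time `0` is among them because class 1
  -- starts empty.
  set B : Set ℝ := {r | 0 ≤ r ∧ r ≤ τ ∧ ¬ (N.InH c l₀ n (N.queue n T r ω) ∧
    threshC c l₀ n - 1 ≤ N.queue n T r ω 2)} with hB
  have hB0 : (0 : ℝ) ∈ B := by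
    refine ⟨le_rfl, hτ, fun hcon => ?_⟩
    have h1 := hcon.1
    rw [InH, h.queue_zero] at h1
    exact absurd h1 (not_le.mpr (mul_pos ha (by linarith)))
  have hBb : BddAbove B := ⟨τ, fun r hr => hr.2.1⟩
  set σ := sSup B
  have hσ0 : 0 ≤ σ := le_csSup hBb hB0
  have hστ : σ ≤ τ := csSup_le ⟨0, hB0⟩ fun r hr => hr.2.1
  have hR : ∀ r ∈ Ioc σ τ, N.InH c l₀ n (N.queue n T r ω) ∧
      threshC c l₀ n - 1 ≤ N.queue n T r ω 2 := by
    intro r hr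
    by_contra hcon
    exact absurd (le_csSup hBb (show r ∈ B from ⟨hσ0.trans hr.1.le, hr.2, hcon⟩))
      (not_le.mpr hr.1)
  have hT0 : T 0 τ ω - T 0 σ ω = τ - σ := by
    refine h.alloc_sub_of_serve hσ0 hστ fun r hr => ?_
    obtain ⟨hH, hC⟩ := hR r hr
    have hq : 0 < N.queue n T r ω 0 :=
      lt_of_lt_of_le (mul_pos ha (by linarith)) hH
    by_cases hA : N.InA l₀ n (N.queue n T r ω)
    · exact Or.inl ⟨hA, hq, Or.inl hC⟩
    · exact Or.inr ⟨hA, Or.inl hH⟩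
  have hT1 : T 1 τ ω = T 1 σ ω := by
    refine h.alloc_eq_of_not_serve hσ0 hστ fun r hr hcon => ?_
    obtain ⟨hH, hC⟩ := hR r hr
    rcases hcon with ⟨-, h1, -⟩ | ⟨-, h1, -⟩
    · exact absurd hC (not_le.mpr h1)
    · exact h1 hH
  -- The supremum `σ` need not lie in `B`, so a nearby `s` in `B` replaces it. Within `ε`, at most
  -- one class 2 completion is added; within `1`, at most one unit of class 1 service is lost.
  obtain ⟨ε, hε, hjump⟩ := exists_renewalCount_le_add_one (h.pos_srv 1) (h.tendsto_srv 1)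
    (h.alloc_nonneg 1 hτ)
  obtain ⟨s, hsB, hs⟩ := exists_lt_of_lt_csSup ⟨0, hB0⟩
    (show σ - min ε 1 < σ by have := lt_min hε one_pos; linarith)
  have hsσ : s ≤ σ := le_csSup hBb hsB
  have hsε : σ ≤ s + ε := by have := min_le_left ε 1; linarith
  have hs1 : σ ≤ s + 1 := by have := min_le_right ε 1; linarith
  refine ⟨s, hsB.1, hsB.2.1, fun hH => ?_, ?_⟩
  -- Class 3 gained at most one customer since `s`, so it was above `C - 1` at `s`; membership in
  -- `B` must then come from class 1.
  · refine hsB.2.2 ⟨hH, ?_⟩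
    have h4 : N.services n 1 (T 1 τ ω) ω ≤ N.services n 1 (T 1 s ω) ω + 1 := by
      refine hjump _ (h.alloc_nonneg 1 hsB.1) (h.alloc_mono 1 hsB.1 hsB.2.1) ?_
      have := h.alloc_sub_le 1 hsB.1 hsσ
      linarith
    have h5 := h.services_mono 2 hsB.1 hsB.2.1
    have h4' : (N.services n 1 (T 1 τ ω) ω : ℝ) ≤ N.services n 1 (T 1 s ω) ω + 1 := by
      exact_mod_cast h4
    have h5' : (N.services n 2 (T 2 s ω) ω : ℝ) ≤ N.services n 2 (T 2 τ ω) ω := by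
      exact_mod_cast h5
    have h6 : N.queue n T τ ω 2 =
      (N.services n 1 (T 1 τ ω) ω : ℝ) - N.services n 2 (T 2 τ ω) ω := rfl
    have h7 : N.queue n T s ω 2 =
      (N.services n 1 (T 1 s ω) ω : ℝ) - N.services n 2 (T 2 s ω) ω := rfl
    linarith
  · have := h.alloc_mono 0 hsB.1 hsσ
    linarith

/-- A large class `1` queue at a time of a long class `3` queue forces a block of service times to
take longer than a block of interarrival times with `q` more customers. -/
theorem exists_blocks (h : N.IsRegularPath P c l₀ g₀ n T ω)
    (hmu : ∀ j, 0 < N.muN n j) (hD : 1 ≤ threshC c l₀ n - threshL l₀ n + 1) {τ : ℝ} (hτ : 0 ≤ τ)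
    (h1 : N.muN n 0 / N.muN n 1 * (3 * (threshC c l₀ n - threshL l₀ n + 1)) ≤ N.queue n T τ ω 0)
    (h3 : threshL l₀ n + 3 * (threshC c l₀ n - threshL l₀ n + 1) ≤ N.queue n T τ ω 2)
    {q : ℕ} (hq : (q : ℝ) + 2 ≤
      N.muN n 0 / N.muN n 1 * (2 * (threshC c l₀ n - threshL l₀ n + 1) - 1)) :
    ∃ i k m, i < N.arrivals n 0 τ ω ∧ k < N.arrivals n 0 τ ω ∧ m < N.arrivals n 0 τ ω ∧
      ∑ x ∈ Finset.Ico i (i + (m + q)), N.u 0 x ω / N.lamN n 0 -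
        ∑ x ∈ Finset.Ico k (k + m), N.v 0 x ω / N.muN n 0 ≤ 1 := by
  obtain ⟨s, hs0, hsτ, hH, hT⟩ := h.exists_not_inH hmu hD hτ h3
  have ha : 0 < N.muN n 0 / N.muN n 1 := div_pos (hmu 0) (hmu 1)
  rw [InH, not_le] at hH
  set i := N.arrivals n 0 s ω with hi
  set j := N.arrivals n 0 τ ω with hj
  set k := N.services n 0 (T 0 s ω) ω with hk
  set l := N.services n 0 (T 0 τ ω) ω with hl
  have hqτ : N.queue n T τ ω 0 = (j : ℝ) - l := rfl
  have hqs : N.queue n T s ω 0 = (i : ℝ) - k := rfl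
  have hkl : k ≤ l := h.services_mono 0 hs0 hsτ
  have hij : i ≤ j := renewalCount_mono (h.tendsto_arr 0) hs0 hsτ
  have hlj : l < j := by
    have : (0 : ℝ) < j - l := by
      rw [← hqτ]
      exact lt_of_lt_of_le (mul_pos ha (by linarith)) h1
    exact_mod_cast sub_pos.mp this
  have hgap : q + 2 + l + i < j + k := by
    have : (q : ℝ) + 2 + l + i < j + k := by
      rw [hqτ] at h1
      rw [hqs] at hH
      nlinarith
    exact_mod_cast this
  have hU1 := sum_range_renewalCount_le (h.tendsto_arr 0) hτ
  have hU2 := lt_sum_range_renewalCount_add_one (h.tendsto_arr 0) s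
  have hV1 := sum_range_renewalCount_le (h.tendsto_srv 0) (h.alloc_nonneg 0 hs0)
  have hV2 := lt_sum_range_renewalCount_add_one (h.tendsto_srv 0) (T 0 τ ω)
  change ∑ x ∈ Finset.range j, N.u 0 x ω / N.lamN n 0 ≤ τ at hU1
  change s < ∑ x ∈ Finset.range (i + 1), N.u 0 x ω / N.lamN n 0 at hU2
  change ∑ x ∈ Finset.range k, N.v 0 x ω / N.muN n 0 ≤ T 0 s ω at hV1
  change T 0 τ ω < ∑ x ∈ Finset.range (l + 1), N.v 0 x ω / N.muN n 0 at hV2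
  have hV3 := sum_range_le_sum_range (h.pos_srv 0)
    (show l + 1 ≤ k + ((j - (i + 1)) - q) by omega)
  -- Arrival `i + 1` occurs after `s` and arrival `j` by `τ`, so the interarrival block is shorter
  -- than `τ - s`. The service block reaches index `l + 1` or beyond, so it exceeds the class 1
  -- service given on `(s, τ]`, which is at least `τ - s - 1`.
  refine ⟨i + 1, k, j - (i + 1) - q, by omega, by omega, by omega, ?_⟩
  rw [Finset.sum_Ico_eq_sub _ (by omega), Finset.sum_Ico_eq_sub _ (by omega),
    show i + 1 + (j - (i + 1) - q + q) = j by omega]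
  linarith

end IsRegularPath

end CrissCross

/-! ### Reduction of the event to two long queues -/

namespace CrissCross

variable {Ω : Type*}

theorem le_threshC_sub_threshL_add_one (c l₀ : ℝ) (n : ℕ) :
    (c - 1) * l₀ * Real.log n ≤ threshC c l₀ n - threshL l₀ n + 1 := by
  have h1 := Int.sub_one_lt_floor (c * l₀ * Real.log n)
  have h2 := Int.floor_le (l₀ * Real.log n)
  rw [threshC, threshL]
  linarith

/-- In the states that make up `eventE`, both class `1` and class `3` are far above their
thresholds. -/
theorem exists_of_mem_eventE (N : CrissCross Ω) {c l₀ κ : ℝ} {n : ℕ} {T : Fin 3 → ℝ → Ω → ℝ}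
    {t : ℝ} {ω : Ω} (hn : 1 ≤ n) (hc : 1 < c) (hl : 0 ≤ l₀) (hmu : ∀ j, 0 < N.muN n j)
    (hrat : N.muN n 0 / N.muN n 1 * 3 ≤ 4 * N.mu 0 / N.mu 1)
    (hD : 1 ≤ threshC c l₀ n - threshL l₀ n + 1) (hκ : N.kappaMin c ≤ κ)
    (hω : ω ∈ N.eventE c l₀ κ n T t) :
    ∃ τ, 0 ≤ τ ∧ τ ≤ n * t ∧
      N.muN n 0 / N.muN n 1 * (3 * (threshC c l₀ n - threshL l₀ n + 1)) ≤ N.queue n T τ ω 0 ∧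
      threshL l₀ n + 3 * (threshC c l₀ n - threshL l₀ n + 1) ≤ N.queue n T τ ω 2 := by
  have hn' : (0 : ℝ) < n := by exact_mod_cast hn
  have hsq : 0 < √(n : ℝ) := Real.sqrt_pos.mpr hn'
  have hlog : 0 ≤ Real.log n := Real.log_natCast_nonneg n
  set D := threshC c l₀ n - threshL l₀ n + 1 with hDdef
  have hk1 : 4 * N.mu 0 / N.mu 1 ≤ κ := ((le_max_left _ _).trans (le_max_left _ _)).trans hκ
  have hk2 : 4 / (c - 1) ≤ κ := ((le_max_right _ _).trans (le_max_left _ _)).trans hκ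
  have hk3 : 4 ≤ κ := ((le_max_right _ _).trans (le_max_right _ _)).trans hκ
  have ha := hmu 0
  have hb := hmu 1
  -- With `4 * D ≤ κ * D`, averaging with weights 1/4 and 3/4 gives `L + 3 * D ≤ κ * D`.
  have hL : 4 * threshL l₀ n ≤ κ * D := by
    have h1 : threshL l₀ n ≤ l₀ * Real.log n := Int.floor_le _
    have h2 : (c - 1) * l₀ * Real.log n ≤ D := le_threshC_sub_threshL_add_one c l₀ n
    have h3 : 0 < c - 1 := by linarith
    have h4 : 0 ≤ (c - 1) * l₀ * Real.log n := by positivity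
    calc 4 * threshL l₀ n ≤ 4 * (l₀ * Real.log n) := by linarith
      _ = 4 / (c - 1) * ((c - 1) * l₀ * Real.log n) := by field_simp
      _ ≤ κ * D := mul_le_mul hk2 h2 h4 (by linarith)
  have hκD : 4 * D ≤ κ * D := mul_le_mul_of_nonneg_right hk3 (by linarith)
  -- The level is nonnegative, so an indicator exceeding it cannot be in its zero case.
  have hbound : 0 ≤ κ * D / √(n : ℝ) := div_nonneg (by nlinarith) hsq.le
  rcases hω with hω | hω
  · rw [mem_ofPred_eq] at hω
    obtain ⟨s, hs⟩ := lt_iSup_iff.mp hω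
    obtain ⟨hst, hs⟩ := lt_iSup_iff.mp hs
    have hs := EReal.coe_lt_coe_iff.mp hs
    have hmem : ω ∈ N.eventA l₀ n T (n * s) := by
      by_contra hcon
      rw [indicator_of_notMem hcon] at hs
      linarith
    rw [indicator_of_mem hmem, queueHat, div_lt_div_iff_of_pos_right hsq] at hs
    have hA : N.queue n T (n * s) ω 2 - N.muN n 1 / N.muN n 0 * N.queue n T (n * s) ω 0 <
      threshL l₀ n := hmem
    refine ⟨n * s, mul_nonneg hn'.le hst.1, mul_le_mul_of_nonneg_left hst.2 hn'.le, ?_, by linarith⟩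
    have h3 : 3 * D ≤ N.muN n 1 / N.muN n 0 * N.queue n T (n * s) ω 0 := by linarith
    calc N.muN n 0 / N.muN n 1 * (3 * D)
        ≤ N.muN n 0 / N.muN n 1 * (N.muN n 1 / N.muN n 0 * N.queue n T (n * s) ω 0) :=
          mul_le_mul_of_nonneg_left h3 (by positivity)
      _ = _ := by field_simp
  · rw [mem_ofPred_eq] at hω
    obtain ⟨s, hs⟩ := lt_iSup_iff.mp hω
    obtain ⟨hst, hs⟩ := lt_iSup_iff.mp hs
    have hs := EReal.coe_lt_coe_iff.mp hs
    have hmem : ω ∈ (N.eventA l₀ n T (n * s))ᶜ := by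
      by_contra hcon
      rw [indicator_of_notMem hcon] at hs
      linarith
    rw [indicator_of_mem hmem, queueHat, div_lt_div_iff_of_pos_right hsq] at hs
    have hA : threshL l₀ n ≤
        N.queue n T (n * s) ω 2 - N.muN n 1 / N.muN n 0 * N.queue n T (n * s) ω 0 :=
      not_lt.mp hmem
    have h1 : N.muN n 0 / N.muN n 1 * (3 * D) ≤ N.queue n T (n * s) ω 0 := by
      have := mul_le_mul_of_nonneg_right (hrat.trans hk1) (show 0 ≤ D by linarith)
      linarith
    refine ⟨n * s, mul_nonneg hn'.le hst.1, mul_le_mul_of_nonneg_left hst.2 hn'.le, h1, ?_⟩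
    have h3 : 3 * D ≤ N.muN n 1 / N.muN n 0 * N.queue n T (n * s) ω 0 := by
      calc 3 * D = N.muN n 1 / N.muN n 0 * (N.muN n 0 / N.muN n 1 * (3 * D)) := by field_simp
        _ ≤ _ := mul_le_mul_of_nonneg_left h1 (by positivity)
    linarith

/-! ### Probability estimates under the standing assumptions -/

namespace Assumptions

variable [MeasurableSpace Ω] {P : Measure Ω} {N : CrissCross Ω}

theorem zero_mem_interior_u (hN : N.Assumptions P) (k : Fin 2) :
    (0 : ℝ) ∈ interior (integrableExpSet (N.u k 0) P) := by
  obtain ⟨O, hO, h0, h⟩ := hN.exp_moments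
  have hc : Continuous fun x : ℝ => x * N.lam k := by fun_prop
  refine mem_interior.mpr ⟨(fun x => x * N.lam k) ⁻¹' O, fun x hx => ?_, hO.preimage hc, by simpa⟩
  refine ((h _ hx).1 k).congr (Eventually.of_forall fun ω => ?_)
  have := (hN.lam_pos k).ne'
  simp only
  field_simp

theorem zero_mem_interior_v (hN : N.Assumptions P) (j : Fin 3) :
    (0 : ℝ) ∈ interior (integrableExpSet (N.v j 0) P) := by
  obtain ⟨O, hO, h0, h⟩ := hN.exp_moments
  have hc : Continuous fun x : ℝ => x * N.mu j := by fun_prop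
  refine mem_interior.mpr ⟨(fun x => x * N.mu j) ⁻¹' O, fun x hx => ?_, hO.preimage hc, by simpa⟩
  refine ((h _ hx).2 j).congr (Eventually.of_forall fun ω => ?_)
  have := (hN.mu_pos j).ne'
  simp only
  field_simp

theorem iIndepFun_u (hN : N.Assumptions P) (k : Fin 2) : iIndepFun (N.u k) P :=
  hN.indep.precomp (g := fun i => Sum.inl (k, i)) fun a b h => by simpa using h

theorem iIndepFun_v (hN : N.Assumptions P) (j : Fin 3) : iIndepFun (N.v j) P :=
  hN.indep.precomp (g := fun i => Sum.inr (j, i)) fun a b h => by simpa using h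

theorem iIndepFun_u_v (hN : N.Assumptions P) (k : Fin 2) (j : Fin 3) :
    iIndepFun (Sum.elim (N.u k) (N.v j)) P := by
  have := hN.indep.precomp (g := Sum.map (fun i : ℕ => (k, i)) (fun i : ℕ => (j, i)))
    (Sum.map_injective.mpr ⟨fun a b h => by simpa using h, fun a b h => by simpa using h⟩)
  convert this using 1
  ext i
  rcases i with i | i <;> rfl

theorem ae_isRegularPath [IsProbabilityMeasure P] (hN : N.Assumptions P) {c l₀ g₀ : ℝ} {n : ℕ}
    {T : Fin 3 → ℝ → Ω → ℝ} (hT : N.IsPolicy P c l₀ g₀ n T) :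
    ∀ᵐ ω ∂P, N.IsRegularPath P c l₀ g₀ n T ω := by
  have hu : ∀ᵐ ω ∂P, ∀ k i, 0 < N.u k i ω :=
    ae_all_iff.mpr fun k => ae_all_iff.mpr fun i => hN.pos_u k i
  have hv : ∀ᵐ ω ∂P, ∀ j i, 0 < N.v j i ω :=
    ae_all_iff.mpr fun j => ae_all_iff.mpr fun i => hN.pos_v j i
  -- A nonintegrable function has Bochner integral `0`, so mean one already yields integrability.
  have hU : ∀ᵐ ω ∂P, ∀ k, Tendsto (fun l => ∑ i ∈ Finset.range l, N.u k i ω) atTop atTop :=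
    ae_all_iff.mpr fun k => ae_tendsto_sum_atTop
      (by by_contra h; have := hN.mean_u k; rw [integral_undef h] at this; norm_num at this)
      (hN.iIndepFun_u k) (hN.ident_u k) (by rw [hN.mean_u]; exact one_pos)
  have hV : ∀ᵐ ω ∂P, ∀ j, Tendsto (fun l => ∑ i ∈ Finset.range l, N.v j i ω) atTop atTop :=
    ae_all_iff.mpr fun j => ae_tendsto_sum_atTop
      (by by_contra h; have := hN.mean_v j; rw [integral_undef h] at this; norm_num at this)
      (hN.iIndepFun_v j) (hN.ident_v j) (by rw [hN.mean_v]; exact one_pos)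
  filter_upwards [hu, hv, hU, hV, hT] with ω h1 h2 h3 h4 h5
  refine ⟨h1, h2, fun k i => div_pos (h1 k i) (hN.lamN_pos n k),
    fun j i => div_pos (h2 j i) (hN.muN_pos n j), fun k => ?_, fun j => ?_, h5⟩
  · simp_rw [← Finset.sum_div]
    exact (h3 k).atTop_div_const (hN.lamN_pos n k)
  · simp_rw [← Finset.sum_div]
    exact (h4 j).atTop_div_const (hN.muN_pos n j)

/-- Class `1` customers arrive more slowly than server `1` can serve them. -/
theorem lam_zero_lt_mu_zero (hN : N.Assumptions P) : N.lam 0 < N.mu 0 := by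
  have h1 := div_pos (hN.lam_pos 1) (hN.mu_pos 1)
  have h2 := hN.heavy_one
  exact (div_lt_one (hN.mu_pos 0)).mp (by linarith)

/-- A tilting parameter `s` and a rate `ρ` strictly between the mean class `1` service and
interarrival times. -/
theorem exists_tilt [IsProbabilityMeasure P] (hN : N.Assumptions P) :
    ∃ s ρ r₁ r₂ : ℝ, 0 < s ∧ 0 < ρ ∧ 1 / N.mu 0 < r₁ ∧ r₂ < 1 / N.lam 0 ∧
      (∀ i, Integrable (fun ω => Real.exp (s * (-r₂ * N.u 0 i ω))) P ∧
        mgf (fun ω => -r₂ * N.u 0 i ω) P s ≤ Real.exp (s * -ρ)) ∧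
      (∀ i, Integrable (fun ω => Real.exp (s * (r₁ * N.v 0 i ω))) P ∧
        mgf (fun ω => r₁ * N.v 0 i ω) P s ≤ Real.exp (s * ρ)) := by
  have hlt := one_div_lt_one_div_of_lt (hN.lam_pos 0) hN.lam_zero_lt_mu_zero
  have hpos := one_div_pos.mpr (hN.mu_pos 0)
  -- The slack of `r₁` and `r₂` around the limiting means lets a single tilt serve every large `n`.
  obtain ⟨ρ, hρ1, hρ2⟩ := exists_between hlt
  obtain ⟨r₁, hr11, hr12⟩ := exists_between hρ1
  obtain ⟨r₂, hr21, hr22⟩ := exists_between hρ2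
  have hu := eventually_mgf_const_mul_le (hN.zero_mem_interior_u 0) (a := -r₂) (ρ := -ρ)
    (by rw [hN.mean_u]; linarith)
  have hv := eventually_mgf_const_mul_le (hN.zero_mem_interior_v 0) (a := r₁) (ρ := ρ)
    (by rw [hN.mean_v]; linarith)
  obtain ⟨s, ⟨hsu, hsv⟩, hs⟩ := ((hu.and hv).and self_mem_nhdsWithin).exists
  refine ⟨s, ρ, r₁, r₂, hs, by linarith, hr11, hr22, fun i => ?_,
    fun i => ?_⟩
  · have hid := (hN.ident_u 0 i).comp (measurable_const_mul (-r₂))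
    have hid' := hid.comp (Real.measurable_exp.comp (measurable_const_mul s))
    refine ⟨hid'.integrable_iff.mpr hsu.1, ?_⟩
    have := congrFun (mgf_congr_identDistrib hid) s
    exact this.trans_le hsu.2
  · have hid := (hN.ident_v 0 i).comp (measurable_const_mul r₁)
    have hid' := hid.comp (Real.measurable_exp.comp (measurable_const_mul s))
    refine ⟨hid'.integrable_iff.mpr hsv.1, ?_⟩
    have := congrFun (mgf_congr_identDistrib hid) s
    exact this.trans_le hsv.2

/-- The probability of `eventE` is at most that of `m` or more class `1` arrivals plus that of an
exceptional pair of blocks among the first `m` customers. -/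
theorem measureReal_eventE_le [IsProbabilityMeasure P] (hN : N.Assumptions P)
    {s ρ r₁ r₂ : ℝ} (hs : 0 < s)
    (hU : ∀ i, Integrable (fun ω => Real.exp (s * (-r₂ * N.u 0 i ω))) P ∧
      mgf (fun ω => -r₂ * N.u 0 i ω) P s ≤ Real.exp (s * -ρ))
    (hV : ∀ i, Integrable (fun ω => Real.exp (s * (r₁ * N.v 0 i ω))) P ∧
      mgf (fun ω => r₁ * N.v 0 i ω) P s ≤ Real.exp (s * ρ))
    {c l₀ g₀ κ : ℝ} {n : ℕ} {T : Fin 3 → ℝ → Ω → ℝ} {t : ℝ} (hT : N.IsPolicy P c l₀ g₀ n T)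
    (hn : 1 ≤ n) (ht : 0 ≤ n * t) (hc : 1 < c) (hl : 0 ≤ l₀) (hκ : N.kappaMin c ≤ κ)
    (hr₁ : 1 / N.muN n 0 ≤ r₁) (hr₂ : r₂ ≤ 1 / N.lamN n 0)
    (hrat : N.muN n 0 / N.muN n 1 * 3 ≤ 4 * N.mu 0 / N.mu 1)
    (hD : 1 ≤ threshC c l₀ n - threshL l₀ n + 1) {q : ℕ} (hq : (q : ℝ) + 2 ≤
      N.muN n 0 / N.muN n 1 * (2 * (threshC c l₀ n - threshL l₀ n + 1) - 1)) (m : ℕ) :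
    P.real (N.eventE c l₀ κ n T t) ≤
      Real.exp (s * (n * t) - s * ρ * m) + m ^ 3 * Real.exp (s - s * ρ * q) := by
  -- Taking `J = ∅` also covers the event of too many arrivals, so one Chernoff bound handles both.
  set F : Finset ℕ → Finset ℕ → ℝ → Set Ω := fun I J x =>
    {ω | r₂ * ∑ i ∈ I, N.u 0 i ω - r₁ * ∑ i ∈ J, N.v 0 i ω ≤ x}
  have hF : ∀ I J x, P.real (F I J x) ≤ Real.exp (s * x - s * ρ * (I.card - J.card)) := fun I J x =>
    measureReal_sum_sub_sum_le (hN.measurable_u 0) (hN.measurable_v 0) (hN.iIndepFun_u_v 0 0)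
      hs.le hU hV I J x
  set R := Finset.range m ×ˢ Finset.range m ×ˢ Finset.range m
  set G : ℕ × ℕ × ℕ → Set Ω := fun p =>
    F (Finset.Ico p.1 (p.1 + (p.2.2 + q))) (Finset.Ico p.2.1 (p.2.1 + p.2.2)) 1
  have hsub : ∀ᵐ ω ∂P, ω ∈ N.eventE c l₀ κ n T t →
      ω ∈ F (Finset.range m) ∅ (n * t) ∪ ⋃ p ∈ R, G p := by
    filter_upwards [hN.ae_isRegularPath hT] with ω hω hE
    obtain ⟨τ, hτ0, hτt, h1, h3⟩ := N.exists_of_mem_eventE hn hc hl (hN.muN_pos n) hrat hD hκ hE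
    obtain ⟨i, k, l, hi, hk, hl, hsum⟩ := hω.exists_blocks (hN.muN_pos n) hD hτ0 h1 h3 hq
    have hu : ∀ I : Finset ℕ, r₂ * ∑ x ∈ I, N.u 0 x ω ≤ ∑ x ∈ I, N.u 0 x ω / N.lamN n 0 := by
      intro I
      rw [Finset.mul_sum]
      refine Finset.sum_le_sum fun x _ => ?_
      rw [div_eq_inv_mul, ← one_div]
      exact mul_le_mul_of_nonneg_right hr₂ (hω.pos_u 0 x).le
    have hv : ∀ I : Finset ℕ, ∑ x ∈ I, N.v 0 x ω / N.muN n 0 ≤ r₁ * ∑ x ∈ I, N.v 0 x ω := by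
      intro I
      rw [Finset.mul_sum]
      refine Finset.sum_le_sum fun x _ => ?_
      rw [div_eq_inv_mul, ← one_div]
      exact mul_le_mul_of_nonneg_right hr₁ (hω.pos_v 0 x).le
    by_cases hm : m ≤ N.arrivals n 0 (n * t) ω
    · refine Or.inl ?_
      have h4 := sum_range_le_sum_range (hω.pos_arr 0) hm
      have h5 : ∑ x ∈ Finset.range (N.arrivals n 0 (n * t) ω), N.u 0 x ω / N.lamN n 0 ≤ n * t :=
        sum_range_renewalCount_le (hω.tendsto_arr 0) ht
      have h6 := hu (Finset.range m)
      simp only [F, mem_ofPred_eq, Finset.sum_empty, mul_zero, sub_zero]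
      linarith
    · refine Or.inr ?_
      have h4 : N.arrivals n 0 τ ω ≤ N.arrivals n 0 (n * t) ω :=
        renewalCount_mono (hω.tendsto_arr 0) hτ0 hτt
      refine mem_iUnion₂.mpr ⟨(i, k, l), ?_, ?_⟩
      · simp only [R, Finset.mem_product, Finset.mem_range]
        omega
      · have h5 := hu (Finset.Ico i (i + (l + q)))
        have h6 := hv (Finset.Ico k (k + l))
        simp only [G, F, mem_ofPred_eq]
        linarith
  have h1 : P.real (N.eventE c l₀ κ n T t) ≤
      P.real (F (Finset.range m) ∅ (n * t) ∪ ⋃ p ∈ R, G p) :=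
    ENNReal.toReal_mono (measure_ne_top _ _) (measure_mono_ae hsub)
  have h2 : P.real (F (Finset.range m) ∅ (n * t)) ≤ Real.exp (s * (n * t) - s * ρ * m) := by
    simpa using hF (Finset.range m) ∅ (n * t)
  have h3 : P.real (⋃ p ∈ R, G p) ≤ m ^ 3 * Real.exp (s - s * ρ * q) := by
    refine (measureReal_biUnion_finset_le R G).trans ?_
    refine (Finset.sum_le_card_nsmul R _ (Real.exp (s - s * ρ * q)) fun p _ => ?_).trans_eq ?_
    -- The two cardinalities differ by `q` whatever the block length.
    · refine (hF _ _ _).trans_eq ?_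
      simp only [Nat.card_Ico, add_tsub_cancel_left]
      push_cast
      ring_nf
    · simp only [R, Finset.card_product, Finset.card_range, nsmul_eq_mul]
      push_cast
      ring
  exact (h1.trans (measureReal_union_le _ _)).trans (add_le_add h2 h3)

end Assumptions

end CrissCross

/-! ### Choice of the constants -/

theorem theorem5p4 {Ω : Type*} [MeasurableSpace Ω] (P : Measure Ω) [IsProbabilityMeasure P]
    (N : CrissCross Ω) (hN : N.Assumptions P) :
    ∃ θ₁ θ₂ θ₃ θ₄ : ℝ, 0 < θ₁ ∧ 0 < θ₂ ∧ 0 < θ₃ ∧ 0 < θ₄ ∧ ∃ n₀ : ℕ,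
      ∀ l₀ c g₀ : ℝ, 1 < l₀ → 1 < c → 0 < g₀ →
      ∀ T : ℕ → Fin 3 → ℝ → Ω → ℝ, (∀ n, N.IsPolicy P c l₀ g₀ n (T n)) →
      ∀ κ : ℝ, N.kappaMin c ≤ κ → ∀ n : ℕ, n₀ ≤ n → ∀ t : ℝ, 2 ≤ n * t →
        P.real (N.eventE c l₀ κ n (T n) t) ≤
          θ₁ * (n * t + 1) ^ 2 * Real.exp (-θ₂ * (n * t)) +
            θ₃ * (n * t + 1) ^ 3 * (n : ℝ) ^ (-θ₄ * (c - 1) * l₀) := by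
  obtain ⟨s, ρ, r₁, r₂, hs, hρ, hr₁, hr₂, hU, hV⟩ := hN.exists_tilt
  have hmu0 := hN.mu_pos 0
  have hmu1 := hN.mu_pos 1
  -- Half the limiting ratio: eventually `muN 0 / muN 1` exceeds `β` and stays below `8 / 3 * β`,
  -- which is 4/3 of the limit.
  set β : ℝ := N.mu 0 / N.mu 1 / 2 with hβ
  have hβ0 : 0 < β := by positivity
  have hrat : Tendsto (fun n => N.muN n 0 / N.muN n 1) atTop (𝓝 (2 * β)) := by
    rw [show 2 * β = N.mu 0 / N.mu 1 by rw [hβ]; ring]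
    exact (hN.tendsto_mu 0).div (hN.tendsto_mu 1) hmu1.ne'
  have e1 : ∀ᶠ n in atTop, 1 / N.muN n 0 < r₁ :=
    ((tendsto_const_nhds (x := (1 : ℝ))).div (hN.tendsto_mu 0) hmu0.ne').eventually_lt_const hr₁
  have e2 : ∀ᶠ n in atTop, r₂ < 1 / N.lamN n 0 :=
    ((tendsto_const_nhds (x := (1 : ℝ))).div (hN.tendsto_lam 0) (hN.lam_pos 0).ne').eventually_const_lt
      hr₂
  have e3 : ∀ᶠ n in atTop, β < N.muN n 0 / N.muN n 1 :=
    hrat.eventually_const_lt (by linarith)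
  have e4 : ∀ᶠ n in atTop, N.muN n 0 / N.muN n 1 < 8 / 3 * β :=
    hrat.eventually_lt_const (by linarith)
  obtain ⟨n₀, hn₀⟩ := eventually_atTop.mp
    (e1.and (e2.and (e3.and (e4.and (eventually_ge_atTop 1)))))
  -- Makes `β * (2 * K - 1) = β + 2`, so that `x ≥ K` leaves room for a natural number `q`, and `K ≥
  -- 1` ensures `1 ≤ D`.
  set K : ℝ := 1 + 1 / β with hK
  have hK1 : 0 < 1 / β := by positivity
  set θ : ℝ := 2 * s * ρ * β with hθ
  have hθ0 : 0 < θ := by positivity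
  -- In `θ₃` the first summand serves `x ≥ K`; the second makes the bound at least `1`, hence
  -- trivial, for `x < K`.
  refine ⟨1, s, (2 / ρ + 1) ^ 3 * Real.exp (s + s * ρ * (3 + β)) + Real.exp (θ * K), θ, one_pos, hs,
    by positivity, hθ0, n₀, ?_⟩
  intro l₀ c g₀ hl₀ hc _ T hT κ hκ n hn t ht
  obtain ⟨h1, h2, h3, h4, h5⟩ := hn₀ n hn
  have hn' : (0 : ℝ) < n := by exact_mod_cast h5
  set y : ℝ := n * t with hy
  set x : ℝ := (c - 1) * l₀ * Real.log n with hx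
  have hrpow : (n : ℝ) ^ (-θ * (c - 1) * l₀) = Real.exp (-θ * x) := by
    rw [Real.rpow_def_of_pos hn', hx]
    ring_nf
  rw [hrpow]
  have hy1 : 1 ≤ y + 1 := by linarith
  have hy2 : 1 ≤ (y + 1) ^ 2 := one_le_pow₀ hy1
  have hy3 : 1 ≤ (y + 1) ^ 3 := one_le_pow₀ hy1
  rcases lt_or_ge x K with hxK | hxK
  · have hexp : 1 ≤ Real.exp (θ * K) * Real.exp (-θ * x) := by
      rw [← Real.exp_add]
      exact Real.one_le_exp (by nlinarith)
    have h6 : 0 ≤ 1 * (y + 1) ^ 2 * Real.exp (-s * y) := by positivity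
    have h7 : 0 ≤ (2 / ρ + 1) ^ 3 * Real.exp (s + s * ρ * (3 + β)) * (y + 1) ^ 3 *
      Real.exp (-θ * x) := by positivity
    have h8 : 1 ≤ (y + 1) ^ 3 * (Real.exp (θ * K) * Real.exp (-θ * x)) :=
      one_le_mul_of_one_le_of_one_le hy3 hexp
    have h9 : P.real (N.eventE c l₀ κ n (T n) t) ≤ 1 := measureReal_le_one
    linarith
  · have hD := CrissCross.le_threshC_sub_threshL_add_one c l₀ n
    set D := CrissCross.threshC c l₀ n - CrissCross.threshL l₀ n + 1
    rw [← hx] at hD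
    have hlow : β * (2 * x - 1) ≤ N.muN n 0 / N.muN n 1 * (2 * D - 1) :=
      mul_le_mul h3.le (by linarith) (by linarith) (by linarith)
    have hbig : 2 ≤ β * (2 * x - 1) := by
      have : β * (2 * K - 1) = β + 2 := by rw [hK]; field_simp; ring
      nlinarith
    set z := N.muN n 0 / N.muN n 1 * (2 * D - 1)
    have hz : 2 ≤ z := hbig.trans hlow
    have hfl : 2 ≤ ⌊z⌋₊ := Nat.le_floor (by exact_mod_cast hz)
    have hq : ((⌊z⌋₊ - 2 : ℕ) : ℝ) + 2 ≤ z := by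
      rw [Nat.cast_sub hfl]
      have := Nat.floor_le (show 0 ≤ z by linarith)
      push_cast
      linarith
    -- The loss of 3 is the 2 subtracted in `q` plus 1 for the floor.
    have hq' : β * (2 * x - 1) - 3 ≤ ((⌊z⌋₊ - 2 : ℕ) : ℝ) := by
      rw [Nat.cast_sub hfl]
      have := Nat.lt_floor_add_one z
      push_cast
      linarith
    set q := ⌊z⌋₊ - 2
    -- Twice `y / ρ`, so that `s * y - s * ρ * m ≤ -s * y`.
    set m := ⌈2 / ρ * y⌉₊
    have hm1 : 2 / ρ * y ≤ m := Nat.le_ceil _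
    have hm2 : (m : ℝ) ≤ (2 / ρ + 1) * (y + 1) := by
      have hρ' : 0 < 2 / ρ := by positivity
      have := Nat.ceil_lt_add_one (show 0 ≤ 2 / ρ * y by positivity)
      nlinarith
    have main := hN.measureReal_eventE_le hs hU hV (hT n) h5 (show 0 ≤ n * t by linarith) hc
      (by linarith) hκ h1.le h2.le
      (by rw [show 4 * N.mu 0 / N.mu 1 = 8 * β by rw [hβ]; ring]; linarith)
      (show 1 ≤ D by linarith) hq m
    have hA : Real.exp (s * y - s * ρ * m) ≤ Real.exp (-s * y) := by
      refine Real.exp_le_exp.mpr ?_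
      have : s * ρ * (2 / ρ * y) = 2 * s * y := by field_simp
      have h6 := mul_le_mul_of_nonneg_left hm1 (show 0 ≤ s * ρ by positivity)
      linarith
    have hB : Real.exp (s - s * ρ * q) ≤
        Real.exp (s + s * ρ * (3 + β)) * Real.exp (-θ * x) := by
      rw [← Real.exp_add]
      refine Real.exp_le_exp.mpr ?_
      have h6 := mul_le_mul_of_nonneg_left hq' (show 0 ≤ s * ρ by positivity)
      rw [hθ]
      linarith
    have hm3 : (m : ℝ) ^ 3 ≤ (2 / ρ + 1) ^ 3 * (y + 1) ^ 3 := by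
      rw [← mul_pow]
      exact pow_le_pow_left₀ (by positivity) hm2 3
    have hC : (m : ℝ) ^ 3 * Real.exp (s - s * ρ * q) ≤ (2 / ρ + 1) ^ 3 * (y + 1) ^ 3 *
        (Real.exp (s + s * ρ * (3 + β)) * Real.exp (-θ * x)) :=
      mul_le_mul hm3 hB (by positivity) (by positivity)
    have hE : 0 ≤ Real.exp (θ * K) * (y + 1) ^ 3 * Real.exp (-θ * x) := by positivity
    have hG : Real.exp (-s * y) ≤ (y + 1) ^ 2 * Real.exp (-s * y) :=
      le_mul_of_one_le_left (by positivity) hy2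
    linarith
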